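/- Let $\ell,d>0$, let $Y=(0,\ell)\times(0,d)$ be the unit cell, and let $G,\rho\in L^\infty(Y)$ be real-valued with $G_{\inf}\le G\le G_{\sup}$ and $\rho_{\inf}\le\rho\le\rho_{\sup}$ a.e. on $Y$ for some positive constants $G_{\inf},G_{\sup},\rho_{\inf},\rho_{\sup}$. Let $H^1_p(Y)$ be the Hilbert space of all complex-valued $g\in L^2(Y)$ with weak gradient $\nabla g\in (L^2(Y))^2$ whose traces on opposite sides of $Y$ coincide, with inner product $\langle g,h\rangle=\int_Y g\,\overline h+\int_Y\nabla g\cdot\overline{\nabla h}$. Fix a frequency $\omega>0$ and a wavenumber $k_2\in\mathbb R$, and let $\mathcal A,\mathcal B,\mathcal C$ be the bounded operators on $H^1_p(Y)$ defined, for all $\phi,\psi\in H^1_p(Y)$, by $$\langle\mathcal A\phi,\psi\rangle = k_2^2\int_Y G\phi\overline\psi - k_2 i\int_Y G\Big(\frac{\partial\phi}{\partial\xi_2}\overline\psi-\phi\frac{\partial\overline\psi}{\partial\xi_2}\Big)-\omega^2\int_Y\rho\,\phi\overline\psi+\int_Y G\,\nabla\phi\cdot\nabla\overline\psi,$$ $$\langle\mathcal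 B\phi,\psi\rangle = -i\int_Y G\Big(\frac{\partial\phi}{\partial\xi_1}\overline\psi-\phi\frac{\partial\overline\psi}{\partial\xi_1}\Big),\qquad \langle\mathcal C\phi,\psi\rangle=\int_Y G\phi\overline\psi .$$ Put $\mathcal T(\lambda)=\mathcal A+\lambda\mathcal B+\lambda^2\mathcal C$ for $\lambda\in\mathbb C$. If $\mathcal T(\lambda)\phi=0$ for some non-zero $\phi\in H^1_p(Y)$, then there is a non-zero $\psi\in H^1_p(Y)$ with $\mathcal T(\overline\lambda)\psi=0$. Hence the eigenvalues of the quadratic eigenvalue problem come in complex-conjugate pairs: if $\kappa\in\mathbb C$ is an eigenvalue, i.e. there is a non-zero $\phi\in H^1_p(Y)$ such that for all $\psi\in H^1_p(Y)$ $$\kappa^2\int_Y G\phi\overline\psi-\kappa\, i\int_Y G\Big(\frac{\partial\phi}{\partial\xi_1}\overline\psi-\phi\frac{\partial\overline\psi}{\partial\xi_1}\Big)+\Big\{k_2^2\int_Y G\phi\overline\psi - k_2 i\int_Y G\Big(\frac{\partial\phi}{\partial\xi_2}\overline\psi-\phi\frac{\partial\overline\psi}{\partial\xi_2}\Big)-\omega^2\int_Y\rho\,\phi\overline\psi+\int_Y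 G\,\nabla\phi\cdot\nabla\overline\psi\Big\}=0,$$ then so is $\overline\kappa$, and conversely. -/

import Mathlib

open MeasureTheory Set
open scoped ENNReal ComplexConjugate

noncomputable section

/-- A two-dimensional medium on the rectangular unit cell `(0, ℓ) × (0, d)`: real coefficients
`G` and `ρ` in `L^∞` of the cell, bounded below and above by positive constants almost everywhere
on the cell.  Only the values of `G` and `ρ` on the cell matter. -/
structure PeriodicMedium where
  ℓ : ℝ
  d : ℝ
  ℓ_pos : 0 < ℓ
  d_pos : 0 < d
  G : ℝ × ℝ → ℝ
  ρ : ℝ × ℝ → ℝ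
  G_meas : AEStronglyMeasurable G (volume.restrict (Ioo 0 ℓ ×ˢ Ioo 0 d))
  ρ_meas : AEStronglyMeasurable ρ (volume.restrict (Ioo 0 ℓ ×ˢ Ioo 0 d))
  Ginf : ℝ
  Gsup : ℝ
  ρinf : ℝ
  ρsup : ℝ
  Ginf_pos : 0 < Ginf
  ρinf_pos : 0 < ρinf
  G_bound : ∀ᵐ ξ ∂(volume.restrict (Ioo 0 ℓ ×ˢ Ioo 0 d)), Ginf ≤ G ξ ∧ G ξ ≤ Gsup
  ρ_bound : ∀ᵐ ξ ∂(volume.restrict (Ioo 0 ℓ ×ˢ Ioo 0 d)), ρinf ≤ ρ ξ ∧ ρ ξ ≤ ρsup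

namespace PeriodicMedium

/-- The unit cell `Y = {0 < ξ₁ < ℓ, 0 < ξ₂ < d}`. -/
def Y (M : PeriodicMedium) : Set (ℝ × ℝ) := Ioo 0 M.ℓ ×ˢ Ioo 0 M.d

/-- The Hilbert space `L²(Y; ℂ)`. -/
abbrev L2Y (M : PeriodicMedium) : Type := Lp ℂ 2 (volume.restrict M.Y)

/-- `gₑ` is the weak derivative of `g` on `Y` in the direction `e`. -/
def HasWeakDeriv (M : PeriodicMedium) (e : ℝ × ℝ) (g gₑ : M.L2Y) : Prop :=
  ∀ η : ℝ × ℝ → ℂ, ContDiff ℝ (⊤ : ℕ∞) η → HasCompactSupport η → tsupport η ⊆ M.Y →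
    ∫ ξ in M.Y, g ξ * fderiv ℝ η ξ e = - ∫ ξ in M.Y, gₑ ξ * η ξ

/-- `g`, with weak derivative `g₁ = ∂g/∂ξ₁`, has the traces `t₀` on the side `ξ₁ = 0` and `t₁` on
the side `ξ₁ = ℓ` (traces of Sobolev functions, characterized by Green's formula against all
functions smooth up to the boundary). -/
def HasTracesFst (M : PeriodicMedium) (g g₁ : M.L2Y)
    (t₀ t₁ : Lp ℂ 2 (volume.restrict (Ioo 0 M.d))) : Prop :=
  ∀ η : ℝ × ℝ → ℂ, ContDiff ℝ (⊤ : ℕ∞) η →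
    ∫ ξ in M.Y, (g ξ * fderiv ℝ η ξ (1, 0) + g₁ ξ * η ξ) =
      ∫ y in Ioo 0 M.d, (t₁ y * η (M.ℓ, y) - t₀ y * η (0, y))

/-- `g`, with weak derivative `g₂ = ∂g/∂ξ₂`, has the traces `t₀` on the side `ξ₂ = 0` and `t₁` on
the side `ξ₂ = d`. -/
def HasTracesSnd (M : PeriodicMedium) (g g₂ : M.L2Y)
    (t₀ t₁ : Lp ℂ 2 (volume.restrict (Ioo 0 M.ℓ))) : Prop :=
  ∀ η : ℝ × ℝ → ℂ, ContDiff ℝ (⊤ : ℕ∞) η →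
    ∫ ξ in M.Y, (g ξ * fderiv ℝ η ξ (0, 1) + g₂ ξ * η ξ) =
      ∫ x in Ioo 0 M.ℓ, (t₁ x * η (x, M.d) - t₀ x * η (x, 0))

/-- `u = (g, g₁, g₂)` consists of a function `g ∈ L²(Y)` and its weak gradient
`(g₁, g₂) ∈ L²(Y)²`, and the traces of `g` on opposite sides of `Y` coincide. -/
def IsH1p (M : PeriodicMedium) (u : PiLp 2 (fun _ : Fin 3 => M.L2Y)) : Prop :=
  M.HasWeakDeriv (1, 0) (u 0) (u 1) ∧ M.HasWeakDeriv (0, 1) (u 0) (u 2) ∧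
  (∃ t, M.HasTracesFst (u 0) (u 1) t t) ∧ (∃ t, M.HasTracesSnd (u 0) (u 2) t t)

/-! ### Integrals against fixed square-integrable functions -/

/-- The functional `u ↦ ∫ u h`. -/
def pair {α : Type} [MeasurableSpace α] {μ : Measure α} {h : α → ℂ} (hh : MemLp h 2 μ) :
    Lp ℂ 2 μ →L[ℂ] ℂ :=
  ((ContinuousLinearMap.mul ℂ ℂ).lpPairing μ 2 2).flip (hh.toLp h)

lemma pair_apply {α : Type} [MeasurableSpace α] {μ : Measure α} {h : α → ℂ} (hh : MemLp h 2 μ)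
    (u : Lp ℂ 2 μ) : pair hh u = ∫ x, u x * h x ∂μ := by
  rw [pair, ContinuousLinearMap.flip_apply, ContinuousLinearMap.lpPairing_eq_integral]
  apply integral_congr_ae
  filter_upwards [hh.coeFn_toLp] with x hx
  simp [hx]

lemma integrable_mul {α : Type} [MeasurableSpace α] {μ : Measure α} {f h : α → ℂ}
    (hf : MemLp f 2 μ) (hh : MemLp h 2 μ) : Integrable (fun x => f x * h x) μ :=
  hf.integrable_mul hh

lemma memLp_compact {X : Type} [TopologicalSpace X] [MeasurableSpace X] [BorelSpace X]
    [SecondCountableTopology X] [T2Space X] {μ : Measure X} [IsFiniteMeasureOnCompacts μ]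
    {K : Set X} (hK : IsCompact K) {h : X → ℂ} (hh : Continuous h) :
    MemLp h 2 (μ.restrict K) := by
  obtain ⟨C, hC⟩ := hK.exists_bound_of_continuousOn hh.continuousOn
  have : IsFiniteMeasure (μ.restrict K) := ⟨by simpa using hK.measure_lt_top⟩
  refine MemLp.of_bound hh.aestronglyMeasurable C ?_
  exact (ae_restrict_iff' hK.measurableSet).2 (Filter.Eventually.of_forall hC)

lemma memLp_Y (M : PeriodicMedium) {h : ℝ × ℝ → ℂ} (hh : Continuous h) :
    MemLp h 2 (volume.restrict M.Y) :=
  (memLp_compact (K := Icc 0 M.ℓ ×ˢ Icc 0 M.d) (isCompact_Icc.prod isCompact_Icc) hh).mono_measure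
    (Measure.restrict_mono (prod_mono Ioo_subset_Icc_self Ioo_subset_Icc_self) le_rfl)

lemma memLp_Ioo {a : ℝ} {h : ℝ → ℂ} (hh : Continuous h) :
    MemLp h 2 (volume.restrict (Ioo 0 a)) :=
  (memLp_compact (K := Icc 0 a) isCompact_Icc hh).mono_measure
    (Measure.restrict_mono Ioo_subset_Icc_self le_rfl)

lemma cont_fderiv {η : ℝ × ℝ → ℂ} (hη : ContDiff ℝ (⊤ : ℕ∞) η) (e : ℝ × ℝ) :
    Continuous (fun ξ => fderiv ℝ η ξ e) :=
  (hη.continuous_fderiv (by simp)).clm_apply continuous_const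

/-! ### The periodic Sobolev space -/

lemma isH1p_add (M : PeriodicMedium) {u v : PiLp 2 (fun _ : Fin 3 => M.L2Y)}
    (hu : M.IsH1p u) (hv : M.IsH1p v) : M.IsH1p (u + v) := by
  have key : ∀ {α : Type} [MeasurableSpace α] {μ : Measure α} {h : α → ℂ} (hh : MemLp h 2 μ)
      (f g : Lp ℂ 2 μ), ∫ x, (f + g : Lp ℂ 2 μ) x * h x ∂μ
        = (∫ x, f x * h x ∂μ) + ∫ x, g x * h x ∂μ := by
    intro α _ μ h hh f g
    simp only [← pair_apply hh, map_add]
  have hm := fun {h : ℝ × ℝ → ℂ} (hh : Continuous h) => M.memLp_Y hh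
  obtain ⟨u1, u2, ⟨s, us⟩, ⟨t, ut⟩⟩ := hu
  obtain ⟨v1, v2, ⟨s', vs⟩, ⟨t', vt⟩⟩ := hv
  refine ⟨fun η h1 h2 h3 => ?_, fun η h1 h2 h3 => ?_, ⟨s + s', fun η h1 => ?_⟩,
    ⟨t + t', fun η h1 => ?_⟩⟩
  · simp only [PiLp.add_apply]
    rw [key (hm (cont_fderiv h1 _)), key (hm h1.continuous), u1 η h1 h2 h3, v1 η h1 h2 h3]
    ring
  · simp only [PiLp.add_apply]
    rw [key (hm (cont_fderiv h1 _)), key (hm h1.continuous), u2 η h1 h2 h3, v2 η h1 h2 h3]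
    ring
  · have a := us η h1
    have b := vs η h1
    have c1 : Continuous fun y : ℝ => η (M.ℓ, y) := h1.continuous.comp (by fun_prop)
    have c2 : Continuous fun y : ℝ => η (0, y) := h1.continuous.comp (by fun_prop)
    simp only [PiLp.add_apply]
    rw [integral_add (integrable_mul (Lp.memLp _) (hm (cont_fderiv h1 _)))
      (integrable_mul (Lp.memLp _) (hm h1.continuous)),
      integral_sub (integrable_mul (Lp.memLp _) (memLp_Ioo c1))
      (integrable_mul (Lp.memLp _) (memLp_Ioo c2))] at a b ⊢
    rw [key (hm (cont_fderiv h1 _)), key (hm h1.continuous), key (memLp_Ioo c1),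
      key (memLp_Ioo c2)]
    linear_combination a + b
  · have a := ut η h1
    have b := vt η h1
    have c1 : Continuous fun y : ℝ => η (y, M.d) := h1.continuous.comp (by fun_prop)
    have c2 : Continuous fun y : ℝ => η (y, 0) := h1.continuous.comp (by fun_prop)
    simp only [PiLp.add_apply]
    rw [integral_add (integrable_mul (Lp.memLp _) (hm (cont_fderiv h1 _)))
      (integrable_mul (Lp.memLp _) (hm h1.continuous)),
      integral_sub (integrable_mul (Lp.memLp _) (memLp_Ioo c1))
      (integrable_mul (Lp.memLp _) (memLp_Ioo c2))] at a b ⊢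
    rw [key (hm (cont_fderiv h1 _)), key (hm h1.continuous), key (memLp_Ioo c1),
      key (memLp_Ioo c2)]
    linear_combination a + b

lemma isH1p_smul (M : PeriodicMedium) (c : ℂ) {u : PiLp 2 (fun _ : Fin 3 => M.L2Y)}
    (hu : M.IsH1p u) : M.IsH1p (c • u) := by
  have key : ∀ {α : Type} [MeasurableSpace α] {μ : Measure α} {h : α → ℂ} (hh : MemLp h 2 μ)
      (f : Lp ℂ 2 μ), ∫ x, (c • f : Lp ℂ 2 μ) x * h x ∂μ = c * (∫ x, f x * h x ∂μ) := by
    intro α _ μ h hh f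
    simp only [← pair_apply hh, map_smul, smul_eq_mul]
  have hm := fun {h : ℝ × ℝ → ℂ} (hh : Continuous h) => M.memLp_Y hh
  obtain ⟨u1, u2, ⟨s, us⟩, ⟨t, ut⟩⟩ := hu
  refine ⟨fun η h1 h2 h3 => ?_, fun η h1 h2 h3 => ?_, ⟨c • s, fun η h1 => ?_⟩,
    ⟨c • t, fun η h1 => ?_⟩⟩
  · simp only [PiLp.smul_apply]
    rw [key (hm (cont_fderiv h1 _)), key (hm h1.continuous), u1 η h1 h2 h3]
    ring
  · simp only [PiLp.smul_apply]
    rw [key (hm (cont_fderiv h1 _)), key (hm h1.continuous), u2 η h1 h2 h3]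
    ring
  · have a := us η h1
    have c1 : Continuous fun y : ℝ => η (M.ℓ, y) := h1.continuous.comp (by fun_prop)
    have c2 : Continuous fun y : ℝ => η (0, y) := h1.continuous.comp (by fun_prop)
    simp only [PiLp.smul_apply]
    rw [integral_add (integrable_mul (Lp.memLp _) (hm (cont_fderiv h1 _)))
      (integrable_mul (Lp.memLp _) (hm h1.continuous)),
      integral_sub (integrable_mul (Lp.memLp _) (memLp_Ioo c1))
      (integrable_mul (Lp.memLp _) (memLp_Ioo c2))] at a ⊢
    rw [key (hm (cont_fderiv h1 _)), key (hm h1.continuous), key (memLp_Ioo c1),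
      key (memLp_Ioo c2)]
    linear_combination c * a
  · have a := ut η h1
    have c1 : Continuous fun y : ℝ => η (y, M.d) := h1.continuous.comp (by fun_prop)
    have c2 : Continuous fun y : ℝ => η (y, 0) := h1.continuous.comp (by fun_prop)
    simp only [PiLp.smul_apply]
    rw [integral_add (integrable_mul (Lp.memLp _) (hm (cont_fderiv h1 _)))
      (integrable_mul (Lp.memLp _) (hm h1.continuous)),
      integral_sub (integrable_mul (Lp.memLp _) (memLp_Ioo c1))
      (integrable_mul (Lp.memLp _) (memLp_Ioo c2))] at a ⊢
    rw [key (hm (cont_fderiv h1 _)), key (hm h1.continuous), key (memLp_Ioo c1),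
      key (memLp_Ioo c2)]
    linear_combination c * a

lemma isH1p_zero (M : PeriodicMedium) : M.IsH1p 0 := by
  have h0 : ∀ {α : Type} [MeasurableSpace α] {μ : Measure α} {h : α → ℂ},
      (fun x => (0 : Lp ℂ 2 μ) x * h x) =ᵐ[μ] 0 := by
    intro α _ μ h
    filter_upwards [Lp.coeFn_zero ℂ 2 μ] with x hx
    rw [hx]; simp
  have hz : ∀ {α : Type} [MeasurableSpace α] {μ : Measure α} {h : α → ℂ},
      ∫ x, (0 : Lp ℂ 2 μ) x * h x ∂μ = 0 := fun {α} _ {μ h} => by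
    rw [integral_congr_ae h0]; simp
  refine ⟨fun η h1 h2 h3 => ?_, fun η h1 h2 h3 => ?_, ⟨0, fun η h1 => ?_⟩, ⟨0, fun η h1 => ?_⟩⟩
  · simp only [PiLp.zero_apply, hz, neg_zero]
  · simp only [PiLp.zero_apply, hz, neg_zero]
  · simp only [PiLp.zero_apply, ← mul_add, ← mul_sub, hz]
  · simp only [PiLp.zero_apply, ← mul_add, ← mul_sub, hz]

/-- The periodic Sobolev space `H¹_p(Y)`.  A function is represented together with its (unique)
weak gradient as `(g, ∂g/∂ξ₁, ∂g/∂ξ₂)`, so that the inner product inherited from `L²(Y)³` is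
`(g, h)_{L²} + (∇g, ∇h)_{L²}`. -/
def H1p (M : PeriodicMedium) : Submodule ℂ (PiLp 2 (fun _ : Fin 3 => M.L2Y)) where
  carrier := {u | M.IsH1p u}
  add_mem' hu hv := M.isH1p_add hu hv
  zero_mem' := M.isH1p_zero
  smul_mem' c _ hu := M.isH1p_smul c hu

/-- The function `φ` itself. -/
def fn {M : PeriodicMedium} (φ : M.H1p) : ℝ × ℝ → ℂ := φ.1 0

/-- The weak partial derivative `∂φ/∂ξ₁`. -/
def d1 {M : PeriodicMedium} (φ : M.H1p) : ℝ × ℝ → ℂ := φ.1 1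

/-- The weak partial derivative `∂φ/∂ξ₂`. -/
def d2 {M : PeriodicMedium} (φ : M.H1p) : ℝ × ℝ → ℂ := φ.1 2

lemma weakDeriv_zero (M : PeriodicMedium) {e : ℝ × ℝ} {g : M.L2Y}
    (h : M.HasWeakDeriv e 0 g) : g = 0 := by
  have hY : IsOpen M.Y := isOpen_Ioo.prod isOpen_Ioo
  have hfin : IsFiniteMeasure (volume.restrict M.Y) := by
    refine ⟨?_⟩
    rw [Measure.restrict_apply_univ]
    exact (measure_mono (prod_mono Ioo_subset_Icc_self Ioo_subset_Icc_self)).trans_lt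
      ((isCompact_Icc (a := (0 : ℝ)) (b := M.ℓ)).prod
        (isCompact_Icc (a := (0 : ℝ)) (b := M.d))).measure_lt_top
  have hi : IntegrableOn g M.Y := (Lp.memLp g).integrable (by norm_num)
  have := hY.ae_eq_zero_of_integral_contDiff_smul_eq_zero hi.locallyIntegrableOn
    (fun θ h1 h2 h3 => by
      have hη : ContDiff ℝ (⊤ : ℕ∞) (fun ξ => (θ ξ : ℂ)) := Complex.ofRealCLM.contDiff.comp h1
      have hs : tsupport (fun ξ => (θ ξ : ℂ)) ⊆ tsupport θ :=
        closure_mono (fun x hx => by simpa using hx)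
      have hc : HasCompactSupport (fun ξ => (θ ξ : ℂ)) :=
        h2.of_isClosed_subset (isClosed_tsupport _) hs
      have a := h _ hη hc (hs.trans h3)
      have b : ∫ ξ in M.Y, (0 : M.L2Y) ξ * fderiv ℝ (fun ξ => (θ ξ : ℂ)) ξ e = 0 := by
        apply integral_eq_zero_of_ae
        filter_upwards [Lp.coeFn_zero ℂ 2 (volume.restrict M.Y)] with x hx
        rw [hx]; simp
      rw [b, eq_comm, neg_eq_zero] at a
      rw [← a, ← setIntegral_eq_integral_of_forall_compl_eq_zero (s := M.Y)]
      · simp [mul_comm]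
      · intro x hx
        rw [image_eq_zero_of_notMem_tsupport (fun hx' => hx (h3 hx')), zero_smul])
  rw [Lp.eq_zero_iff_ae_eq_zero]
  exact (ae_restrict_iff' hY.measurableSet).2 this

/-- An element of `H¹_p(Y)` is determined by the function alone, i.e. `H¹_p(Y)` embeds into
`L²(Y)`. -/
lemma fn_ae_zero_iff {M : PeriodicMedium} (φ : M.H1p) :
    fn φ =ᵐ[volume.restrict M.Y] 0 ↔ φ = 0 := by
  constructor
  · intro h
    have h0 : φ.1 0 = 0 := (Lp.eq_zero_iff_ae_eq_zero).2 h
    obtain ⟨a, b, -⟩ := φ.2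
    rw [h0] at a b
    apply Subtype.ext
    ext1 i
    fin_cases i
    · exact h0
    · exact M.weakDeriv_zero a
    · exact M.weakDeriv_zero b
  · rintro rfl
    exact Lp.coeFn_zero _ _ _

/-! ### Completeness -/

lemma exists_trace {μ : Measure (ℝ × ℝ)} {σ : Measure ℝ} {π : ℝ × ℝ → ℝ} {c : ℝ≥0∞}
    (hc : c ≠ ⊤) (hc0 : c ≠ 0) (hπ : MeasurePreserving π μ (c • σ)) (w : Lp ℂ 2 μ) :
    ∃ t : Lp ℂ 2 σ, ∀ k : ℝ → ℂ, MemLp k 2 σ → ∫ y, t y * k y ∂σ = ∫ ξ, w ξ * k (π ξ) ∂μ := by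
  let N : Lp ℂ 2 (c • σ) →L[ℂ] Lp ℂ 2 μ :=
    (Lp.compMeasurePreservingₗᵢ ℂ π hπ).toContinuousLinearMap
  let s : Lp ℂ 2 (c • σ) := N.adjoint w
  have hle : σ ≤ c⁻¹ • (c • σ) := by
    rw [smul_smul, ENNReal.inv_mul_cancel hc0 hc, one_smul]
  have hs : MemLp s 2 σ := (Lp.memLp s).of_measure_le_smul (by simpa using hc0) hle
  have hac : σ ≪ c • σ := Measure.absolutelyContinuous_of_le_smul hle
  refine ⟨c.toReal • hs.toLp s, fun k hk => ?_⟩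
  have hk' : MemLp (fun y => conj (k y)) 2 (c • σ) :=
    hk.star.smul_measure hc
  have h1 : inner ℂ (hk'.toLp _) s = inner ℂ (N (hk'.toLp _)) w :=
    ContinuousLinearMap.adjoint_inner_right N _ _
  rw [L2.inner_def, L2.inner_def, integral_smul_measure] at h1
  have h2 : ∫ a, inner ℂ (hk'.toLp _ a) (s a) ∂σ = ∫ y, s y * k y ∂σ := by
    apply integral_congr_ae
    filter_upwards [hac.ae_le hk'.coeFn_toLp] with y hy
    rw [hy]
    simp [mul_comm]
  have h3 : ∫ a, inner ℂ (N (hk'.toLp _) a) (w a) ∂μ = ∫ ξ, w ξ * k (π ξ) ∂μ := by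
    apply integral_congr_ae
    have e1 : N (hk'.toLp _) =ᵐ[μ] (hk'.toLp _) ∘ π := Lp.coeFn_compMeasurePreserving _ hπ
    filter_upwards [e1, hπ.quasiMeasurePreserving.ae_eq_comp hk'.coeFn_toLp] with y hy hy'
    rw [hy, hy']
    simp [mul_comm]
  rw [h2, h3] at h1
  rw [← h1, ← integral_smul]
  apply integral_congr_ae
  filter_upwards [Lp.coeFn_smul c.toReal (hs.toLp s), hs.coeFn_toLp] with y hy hy'
  rw [hy, Pi.smul_apply, hy', smul_mul_assoc]

lemma isClosed_trace (M : PeriodicMedium) (i : Fin 3) {e : ℝ × ℝ} {X π : ℝ × ℝ →L[ℝ] ℝ}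
    {ι : ℝ →L[ℝ] ℝ × ℝ} {L a : ℝ} (hL : L ≠ 0) {c : ℝ≥0∞} (hc : c ≠ ⊤) (hc0 : c ≠ 0)
    (hπ : MeasurePreserving π (volume.restrict M.Y) (c • volume.restrict (Ioo 0 a)))
    (hXe : X e = 1) (hπe : π e = 0) (hXι : ∀ y, X (ι y) = 0) (hπι : ∀ y, π (ι y) = y) :
    IsClosed {u : PiLp 2 (fun _ : Fin 3 => M.L2Y) | ∃ t : Lp ℂ 2 (volume.restrict (Ioo 0 a)),
      ∀ η : ℝ × ℝ → ℂ, ContDiff ℝ (⊤ : ℕ∞) η →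
        ∫ ξ in M.Y, (u 0 ξ * fderiv ℝ η ξ e + u i ξ * η ξ) =
          ∫ y in Ioo 0 a, (t y * η (ι y + L • e) - t y * η (ι y))} := by
  have hm := fun {h : ℝ × ℝ → ℂ} (hh : Continuous h) => M.memLp_Y hh
  have hsplit : ∀ (u : PiLp 2 (fun _ : Fin 3 => M.L2Y)) (η : ℝ × ℝ → ℂ) (h : ContDiff ℝ (⊤ : ℕ∞) η),
      ∫ ξ in M.Y, (u 0 ξ * fderiv ℝ η ξ e + u i ξ * η ξ) =
        pair (hm (cont_fderiv h e)) (u 0) + pair (hm h.continuous) (u i) := by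
    intro u η h
    rw [integral_add (integrable_mul (Lp.memLp _) (hm (cont_fderiv h _)))
      (integrable_mul (Lp.memLp _) (hm h.continuous)), pair_apply, pair_apply]
  have hset : {u : PiLp 2 (fun _ : Fin 3 => M.L2Y) |
      ∃ t : Lp ℂ 2 (volume.restrict (Ioo 0 a)),
      ∀ η : ℝ × ℝ → ℂ, ContDiff ℝ (⊤ : ℕ∞) η →
        ∫ ξ in M.Y, (u 0 ξ * fderiv ℝ η ξ e + u i ξ * η ξ) =
          ∫ y in Ioo 0 a, (t y * η (ι y + L • e) - t y * η (ι y))} =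
      ⋂ η : {η : ℝ × ℝ → ℂ // ContDiff ℝ (⊤ : ℕ∞) η ∧ ∀ y, η (ι y + L • e) = η (ι y)},
        {u | pair (hm (cont_fderiv η.2.1 e)) (u 0) + pair (hm η.2.1.continuous) (u i) = 0} := by
    ext u
    simp only [mem_ofPred_eq, mem_iInter]
    constructor
    · rintro ⟨t, ht⟩ ⟨η, h1, h2⟩
      have := ht η h1
      rw [hsplit u η h1] at this
      simpa [h2] using this
    · intro h
      have hXc : Continuous fun ξ : ℝ × ℝ => ((X ξ / L : ℝ) : ℂ) := by fun_prop
      have hw : MemLp (fun ξ => (L⁻¹ : ℂ) * u 0 ξ + ((X ξ / L : ℝ) : ℂ) * u i ξ) 2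
          (volume.restrict M.Y) := by
        refine ((Lp.memLp (u 0)).const_mul _).add ?_
        obtain ⟨C, hC⟩ := (((isCompact_Icc (a := (0 : ℝ)) (b := M.ℓ)).prod
          (isCompact_Icc (a := (0 : ℝ)) (b := M.d))).exists_bound_of_continuousOn
            hXc.continuousOn)
        refine MemLp.of_le_mul (c := C) (Lp.memLp (u i))
          (hXc.aestronglyMeasurable.mul (Lp.aestronglyMeasurable _)) ?_
        refine (ae_restrict_iff' (measurableSet_Ioo.prod measurableSet_Ioo)).2
          (Filter.Eventually.of_forall fun ξ hξ => ?_)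
        rw [norm_mul]
        exact mul_le_mul_of_nonneg_right
          (hC ξ ⟨Ioo_subset_Icc_self hξ.1, Ioo_subset_Icc_self hξ.2⟩) (norm_nonneg _)
      obtain ⟨t, ht⟩ := exists_trace hc hc0 hπ (hw.toLp _)
      refine ⟨t, fun η hη => ?_⟩
      let k : ℝ → ℂ := fun y => η (ι y + L • e) - η (ι y)
      have hk : ContDiff ℝ (⊤ : ℕ∞) k := by
        apply ContDiff.sub
        · exact hη.comp (ι.contDiff.add contDiff_const)
        · exact hη.comp ι.contDiff
      let q : ℝ × ℝ → ℂ := fun ξ => ((X ξ / L : ℝ) : ℂ) * k (π ξ)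
      have hq : ContDiff ℝ (⊤ : ℕ∞) q :=
        (Complex.ofRealCLM.contDiff.comp (X.contDiff.div_const L)).mul (hk.comp π.contDiff)
      have hdq : ∀ ξ, fderiv ℝ q ξ e = (L⁻¹ : ℂ) * k (π ξ) := by
        intro ξ
        have hline : HasDerivAt (fun s : ℝ => q (ξ + s • e)) (fderiv ℝ q ξ e) 0 := by
          have h1 : HasFDerivAt q (fderiv ℝ q ξ) (ξ + (0 : ℝ) • e) := by
            simpa using (hq.differentiable (by simp) ξ).hasFDerivAt
          have h2 : HasDerivAt (fun s : ℝ => ξ + s • e) e 0 := by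
            simpa using ((hasDerivAt_id (0 : ℝ)).smul_const e).const_add ξ
          exact h1.comp_hasDerivAt (0 : ℝ) h2
        have hexp : (fun s : ℝ => q (ξ + s • e)) =
            fun s : ℝ => (((X ξ + s) / L : ℝ) : ℂ) * k (π ξ) := by
          funext s
          simp [q, hXe, hπe]
        rw [hexp] at hline
        have h3 : HasDerivAt (fun s : ℝ => (((X ξ + s) / L : ℝ) : ℂ) * k (π ξ))
            (((1 / L : ℝ) : ℂ) * k (π ξ)) 0 :=
          ((((hasDerivAt_id (0 : ℝ)).const_add (X ξ)).div_const L).ofReal_comp).mul_const _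
        rw [hline.unique h3]
        simp
      let ζ : ℝ × ℝ → ℂ := fun ξ => η ξ - q ξ
      have hζ : ContDiff ℝ (⊤ : ℕ∞) ζ := hη.sub hq
      have hζp : ∀ y, ζ (ι y + L • e) = ζ (ι y) := by
        intro y
        simp [ζ, q, k, hXe, hπe, hXι, hπι, hL]
      have h0 := h ⟨ζ, hζ, hζp⟩
      have e1 := pair_apply (hm (cont_fderiv hζ e)) (u 0)
      have e2 := pair_apply (hm hζ.continuous) (u i)
      have hdζ : ∀ ξ, fderiv ℝ ζ ξ e = fderiv ℝ η ξ e - fderiv ℝ q ξ e := by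
        intro ξ
        have := fderiv_fun_sub (hη.differentiable (by simp) ξ) (hq.differentiable (by simp) ξ)
        simp only [ζ]
        rw [this]
        rfl
      have hkk := ht k (memLp_Ioo hk.continuous)
      have hR : ∫ y in Ioo 0 a, (t y * η (ι y + L • e) - t y * η (ι y)) =
          ∫ y in Ioo 0 a, t y * k y := by
        simp only [k, mul_sub]
      have hW : ∫ ξ in M.Y, (hw.toLp _) ξ * k (π ξ) =
          (∫ ξ in M.Y, u 0 ξ * fderiv ℝ q ξ e) + ∫ ξ in M.Y, u i ξ * q ξ := by
        rw [← integral_add (integrable_mul (Lp.memLp _) (hm (cont_fderiv hq _)))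
          (integrable_mul (Lp.memLp _) (hm hq.continuous))]
        apply integral_congr_ae
        filter_upwards [hw.coeFn_toLp] with ξ hξ
        rw [hξ, hdq ξ]
        simp only [q]
        ring
      have s1 : ∫ ξ in M.Y, u 0 ξ * fderiv ℝ ζ ξ e =
          (∫ ξ in M.Y, u 0 ξ * fderiv ℝ η ξ e) - ∫ ξ in M.Y, u 0 ξ * fderiv ℝ q ξ e := by
        rw [← integral_sub (integrable_mul (Lp.memLp _) (hm (cont_fderiv hη _)))
          (integrable_mul (Lp.memLp _) (hm (cont_fderiv hq _)))]
        simp only [hdζ, mul_sub]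
      have s2 : ∫ ξ in M.Y, u i ξ * ζ ξ =
          (∫ ξ in M.Y, u i ξ * η ξ) - ∫ ξ in M.Y, u i ξ * q ξ := by
        rw [← integral_sub (integrable_mul (Lp.memLp _) (hm hη.continuous))
          (integrable_mul (Lp.memLp _) (hm hq.continuous))]
        simp only [ζ, mul_sub]
      rw [hR, hkk, hW, hsplit u η hη, pair_apply, pair_apply]
      have h0' : pair (hm (cont_fderiv hζ e)) (u 0) + pair (hm hζ.continuous) (u i) = 0 := h0
      rw [e1, e2, s1, s2] at h0'
      linear_combination h0'
  rw [hset]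
  refine isClosed_iInter fun η => isClosed_eq ?_ continuous_const
  exact ((pair _).continuous.comp (PiLp.continuous_apply 2 _ 0)).add
    ((pair _).continuous.comp (PiLp.continuous_apply 2 _ i))

lemma isClosed_weakDeriv (M : PeriodicMedium) (i : Fin 3) (e : ℝ × ℝ) :
    IsClosed {u : PiLp 2 (fun _ : Fin 3 => M.L2Y) | M.HasWeakDeriv e (u 0) (u i)} := by
  simp only [HasWeakDeriv, ofPred_forall]
  refine isClosed_iInter fun η => isClosed_iInter fun h => isClosed_iInter fun _ =>
    isClosed_iInter fun _ => ?_
  simp only [← pair_apply (M.memLp_Y (cont_fderiv h e)), ← pair_apply (M.memLp_Y h.continuous)]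
  exact isClosed_eq ((pair _).continuous.comp (PiLp.continuous_apply 2 _ 0))
    ((pair _).continuous.comp (PiLp.continuous_apply 2 _ i)).neg

lemma measure_Y (M : PeriodicMedium) : (volume : Measure (ℝ × ℝ)).restrict M.Y =
    (volume.restrict (Ioo 0 M.ℓ)).prod (volume.restrict (Ioo 0 M.d)) := by
  rw [Measure.prod_restrict]; rfl

lemma isClosed_H1p (M : PeriodicMedium) :
    IsClosed (M.H1p : Set (PiLp 2 (fun _ : Fin 3 => M.L2Y))) := by
  have h1 := M.isClosed_weakDeriv 1 (1, 0)
  have h2 := M.isClosed_weakDeriv 2 (0, 1)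
  have h3 := M.isClosed_trace 1 (e := (1, 0)) (X := .fst ℝ ℝ ℝ) (π := .snd ℝ ℝ ℝ)
    (ι := .inr ℝ ℝ ℝ) (L := M.ℓ) (a := M.d) M.ℓ_pos.ne' (c := ENNReal.ofReal M.ℓ) (by simp)
    (by simpa using M.ℓ_pos)
    ⟨measurable_snd, by
      rw [measure_Y]; simp [Measure.map_snd_prod]⟩
    (by simp) (by simp) (by simp) (by simp)
  have h4 := M.isClosed_trace 2 (e := (0, 1)) (X := .snd ℝ ℝ ℝ) (π := .fst ℝ ℝ ℝ)
    (ι := .inl ℝ ℝ ℝ) (L := M.d) (a := M.ℓ) M.d_pos.ne' (c := ENNReal.ofReal M.d) (by simp)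
    (by simpa using M.d_pos)
    ⟨measurable_fst, by
      rw [measure_Y]; simp [Measure.map_fst_prod]⟩
    (by simp) (by simp) (by simp) (by simp)
  have := h1.inter (h2.inter (h3.inter h4))
  convert this using 1
  ext u
  simp [H1p, IsH1p, HasTracesFst, HasTracesSnd]

instance (M : PeriodicMedium) : CompleteSpace M.H1p := M.isClosed_H1p.completeSpace_coe

/-! ### The sesquilinear forms and the operators -/

/-- `∫_Y G φ ψ̄`. -/
def formC (M : PeriodicMedium) (φ ψ : M.H1p) : ℂ :=
  ∫ ξ in M.Y, (M.G ξ : ℂ) * fn φ ξ * conj (fn ψ ξ)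

/-- `-i ∫_Y G (∂φ/∂ξ₁ ψ̄ - φ ∂ψ̄/∂ξ₁)`. -/
def formB (M : PeriodicMedium) (φ ψ : M.H1p) : ℂ :=
  -Complex.I * ∫ ξ in M.Y, (M.G ξ : ℂ) * (d1 φ ξ * conj (fn ψ ξ) - fn φ ξ * conj (d1 ψ ξ))

/-- `k₂² ∫_Y G φ ψ̄ - k₂ i ∫_Y G (∂φ/∂ξ₂ ψ̄ - φ ∂ψ̄/∂ξ₂) - ω² ∫_Y ρ φ ψ̄ + ∫_Y G ∇φ · ∇ψ̄`. -/
def formA (M : PeriodicMedium) (ω k₂ : ℝ) (φ ψ : M.H1p) : ℂ :=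
  (k₂ : ℂ) ^ 2 * (∫ ξ in M.Y, (M.G ξ : ℂ) * fn φ ξ * conj (fn ψ ξ))
  - (k₂ : ℂ) * Complex.I *
      (∫ ξ in M.Y, (M.G ξ : ℂ) * (d2 φ ξ * conj (fn ψ ξ) - fn φ ξ * conj (d2 ψ ξ)))
  - (ω : ℂ) ^ 2 * (∫ ξ in M.Y, (M.ρ ξ : ℂ) * fn φ ξ * conj (fn ψ ξ))
  + ∫ ξ in M.Y, (M.G ξ : ℂ) * (d1 φ ξ * conj (d1 ψ ξ) + d2 φ ξ * conj (d2 ψ ξ))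

/-- `κ` is an eigenvalue of the quadratic eigenvalue problem in weak form at `(ω, k₂)`: some
nonzero `φ ∈ H¹_p(Y)` satisfies the weak equation for every `ψ ∈ H¹_p(Y)`. -/
def IsEigenvalue (M : PeriodicMedium) (ω k₂ : ℝ) (κ : ℂ) : Prop :=
  ∃ φ : M.H1p, φ ≠ 0 ∧ ∀ ψ : M.H1p,
    κ ^ 2 * (∫ ξ in M.Y, (M.G ξ : ℂ) * fn φ ξ * conj (fn ψ ξ))
    - κ * (Complex.I *
        ∫ ξ in M.Y, (M.G ξ : ℂ) * (d1 φ ξ * conj (fn ψ ξ) - fn φ ξ * conj (d1 ψ ξ)))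
    + ((k₂ : ℂ) ^ 2 * (∫ ξ in M.Y, (M.G ξ : ℂ) * fn φ ξ * conj (fn ψ ξ))
      - (k₂ : ℂ) * Complex.I *
          (∫ ξ in M.Y, (M.G ξ : ℂ) * (d2 φ ξ * conj (fn ψ ξ) - fn φ ξ * conj (d2 ψ ξ)))
      - (ω : ℂ) ^ 2 * (∫ ξ in M.Y, (M.ρ ξ : ℂ) * fn φ ξ * conj (fn ψ ξ))
      + ∫ ξ in M.Y, (M.G ξ : ℂ) * (d1 φ ξ * conj (d1 ψ ξ) + d2 φ ξ * conj (d2 ψ ξ))) = 0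

lemma memLp_top {μ : Measure (ℝ × ℝ)} {f : ℝ × ℝ → ℝ} {a b : ℝ}
    (hf : AEStronglyMeasurable f μ) (ha : 0 < a) (h : ∀ᵐ ξ ∂μ, a ≤ f ξ ∧ f ξ ≤ b) :
    MemLp (fun ξ => (f ξ : ℂ)) ⊤ μ := by
  refine memLp_top_of_bound (Complex.continuous_ofReal.comp_aestronglyMeasurable hf) b ?_
  filter_upwards [h] with ξ hξ
  simpa [abs_of_pos (ha.trans_le hξ.1)] using hξ.2

lemma memLp_G (M : PeriodicMedium) : MemLp (fun ξ => (M.G ξ : ℂ)) ⊤ (volume.restrict M.Y) :=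
  memLp_top M.G_meas M.Ginf_pos M.G_bound

lemma memLp_ρ (M : PeriodicMedium) : MemLp (fun ξ => (M.ρ ξ : ℂ)) ⊤ (volume.restrict M.Y) :=
  memLp_top M.ρ_meas M.ρinf_pos M.ρ_bound

lemma integrable_form (M : PeriodicMedium) {a : ℝ × ℝ → ℂ}
    (ha : MemLp a ⊤ (volume.restrict M.Y)) (u v : M.L2Y) :
    Integrable (fun ξ => a ξ * (u ξ * conj (v ξ))) (volume.restrict M.Y) := by
  have h1 : MemLp (fun ξ => a ξ * u ξ) 2 (volume.restrict M.Y) := (Lp.memLp u).mul ha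
  simpa [mul_assoc] using integrable_mul h1 (Lp.memLp v).star

lemma exists_op (M : PeriodicMedium) {a : ℝ × ℝ → ℂ} (ha : MemLp a ⊤ (volume.restrict M.Y))
    (i j : Fin 3) : ∃ T : M.H1p →L[ℂ] M.H1p, ∀ φ ψ : M.H1p,
      inner ℂ ψ (T φ) = ∫ ξ in M.Y, a ξ * (φ.1 i ξ * conj (ψ.1 j ξ)) := by
  let P : Fin 3 → (M.H1p →L[ℂ] M.L2Y) := fun i =>
    (PiLp.proj 2 (fun _ : Fin 3 => M.L2Y) i : _ →L[ℂ] M.L2Y) ∘L M.H1p.subtypeL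
  let m : M.L2Y →L[ℂ] M.L2Y :=
    (ContinuousLinearMap.mul ℂ ℂ).holderL (volume.restrict M.Y) ⊤ 2 2 (ha.toLp a)
  refine ⟨(P j).adjoint ∘L m ∘L (P i), fun φ ψ => ?_⟩
  simp only [ContinuousLinearMap.comp_apply]
  rw [ContinuousLinearMap.adjoint_inner_right, L2.inner_def]
  apply integral_congr_ae
  have h1 : m (P i φ) =ᵐ[volume.restrict M.Y] _ :=
    (ContinuousLinearMap.mul ℂ ℂ).coeFn_holder (ha.toLp a) (P i φ)
  filter_upwards [h1, ha.coeFn_toLp] with ξ h2 h3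
  rw [h2, h3]
  simp [P, mul_assoc]

lemma exists_opC (M : PeriodicMedium) :
    ∃ T : M.H1p →L[ℂ] M.H1p, ∀ φ ψ : M.H1p, inner ℂ ψ (T φ) = M.formC φ ψ := by
  obtain ⟨T, hT⟩ := M.exists_op M.memLp_G 0 0
  exact ⟨T, fun φ ψ => by simp only [hT, formC, fn, mul_assoc]⟩

lemma exists_opB (M : PeriodicMedium) :
    ∃ T : M.H1p →L[ℂ] M.H1p, ∀ φ ψ : M.H1p, inner ℂ ψ (T φ) = M.formB φ ψ := by
  obtain ⟨T, hT⟩ := M.exists_op M.memLp_G 1 0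
  obtain ⟨S, hS⟩ := M.exists_op M.memLp_G 0 1
  refine ⟨-Complex.I • (T - S), fun φ ψ => ?_⟩
  have hi := M.integrable_form M.memLp_G
  simp only [formB, fn, d1, mul_sub]
  rw [integral_sub (hi _ _) (hi _ _), _root_.smul_apply, inner_smul_right,
    _root_.sub_apply, inner_sub_right, hT, hS, mul_sub]

lemma exists_opA (M : PeriodicMedium) (ω k₂ : ℝ) :
    ∃ T : M.H1p →L[ℂ] M.H1p, ∀ φ ψ : M.H1p, inner ℂ ψ (T φ) = M.formA ω k₂ φ ψ := by
  obtain ⟨T₁, h₁⟩ := M.exists_op M.memLp_G 0 0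
  obtain ⟨T₂, h₂⟩ := M.exists_op M.memLp_G 2 0
  obtain ⟨T₃, h₃⟩ := M.exists_op M.memLp_G 0 2
  obtain ⟨T₄, h₄⟩ := M.exists_op M.memLp_ρ 0 0
  obtain ⟨T₅, h₅⟩ := M.exists_op M.memLp_G 1 1
  obtain ⟨T₆, h₆⟩ := M.exists_op M.memLp_G 2 2
  refine ⟨(k₂ : ℂ) ^ 2 • T₁ - ((k₂ : ℂ) * Complex.I) • (T₂ - T₃) - (ω : ℂ) ^ 2 • T₄ + (T₅ + T₆),
    fun φ ψ => ?_⟩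
  have hi := M.integrable_form M.memLp_G
  simp only [formA, fn, d1, d2, mul_sub, mul_add]
  rw [integral_sub (hi _ _) (hi _ _), integral_add (hi _ _) (hi _ _)]
  have hs : ∀ (c : ℂ) (T : M.H1p →L[ℂ] M.H1p), inner ℂ ψ ((c • T) φ) = c * inner ℂ ψ (T φ) :=
    fun c T => by rw [_root_.smul_apply, inner_smul_right]
  rw [_root_.add_apply, _root_.sub_apply, _root_.sub_apply, _root_.add_apply, inner_add_right,
    inner_sub_right, inner_sub_right, inner_add_right, hs, hs, hs, _root_.sub_apply,
    inner_sub_right, h₁, h₂, h₃, h₄, h₅, h₆]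
  simp only [mul_assoc, mul_sub]

/-- The bounded operator `𝒜` on `H¹_p(Y)` defined by `⟨𝒜φ, ψ⟩ = formA φ ψ` (the pairing being
linear in the first entry, which is the second entry of `inner`). -/
def opA (M : PeriodicMedium) (ω k₂ : ℝ) : M.H1p →L[ℂ] M.H1p := (M.exists_opA ω k₂).choose

/-- The bounded operator `ℬ` on `H¹_p(Y)` defined by `⟨ℬφ, ψ⟩ = formB φ ψ`. -/
def opB (M : PeriodicMedium) : M.H1p →L[ℂ] M.H1p := M.exists_opB.choose

/-- The bounded operator `𝒞` on `H¹_p(Y)` defined by `⟨𝒞φ, ψ⟩ = formC φ ψ`. -/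
def opC (M : PeriodicMedium) : M.H1p →L[ℂ] M.H1p := M.exists_opC.choose

lemma inner_opA (M : PeriodicMedium) (ω k₂ : ℝ) (φ ψ : M.H1p) :
    inner ℂ ψ (M.opA ω k₂ φ) = M.formA ω k₂ φ ψ := (M.exists_opA ω k₂).choose_spec φ ψ

lemma inner_opB (M : PeriodicMedium) (φ ψ : M.H1p) :
    inner ℂ ψ (M.opB φ) = M.formB φ ψ := M.exists_opB.choose_spec φ ψ

lemma inner_opC (M : PeriodicMedium) (φ ψ : M.H1p) :
    inner ℂ ψ (M.opC φ) = M.formC φ ψ := M.exists_opC.choose_spec φ ψ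

/-- The quadratic operator pencil `𝒯(z) = 𝒜 + z ℬ + z² 𝒞`. -/
def pencil (M : PeriodicMedium) (ω k₂ : ℝ) (z : ℂ) : M.H1p →L[ℂ] M.H1p :=
  M.opA ω k₂ + z • M.opB + z ^ 2 • M.opC

end PeriodicMedium

end

noncomputable section

/-! ### Compact operators between Hilbert spaces -/

section Compact

variable {H L ι : Type*} [NormedAddCommGroup H] [InnerProductSpace ℂ H]
  [NormedAddCommGroup L] [InnerProductSpace ℂ L]

/-! Since `G`, `ρ`, `ω` and `k₂` are real, the three coefficient operators are self-adjoint, so the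
adjoint of the pencil at `z` is the pencil at `conj z` (`adjoint_pencil`). An eigenvalue `z` makes
the pencil at `z` non-invertible, hence also the pencil at `conj z`. In infinite dimension this does
not yet give a kernel vector.

The gap is closed by the Fredholm alternative (`exists_ne_zero_of_not_isUnit_add`), because each
pencil is an invertible operator plus a compact one (`exists_pencil_eq_add`). The invertible part is
the coercive form `∫ G (φ ψ̄ + ∇φ · ∇ψ̄)`; every remaining term contains `φ` or `ψ` undifferentiated
and is compact by Rellich's theorem (`isCompactOperator_embedding`).

Rellich's theorem is proved by Fourier series. Equal traces cancel the boundary terms in Green's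
formula against periodic exponentials, so differentiation multiplies the Fourier coefficients by the
frequency. High modes of `φ` are then small relative to those of its gradient, and the embedding
into `L²(Y)` is a norm limit of finite rank operators. -/

lemma ContinuousLinearMap.isUnit_of_isUnit_adjoint [CompleteSpace H] {T : H →L[ℂ] H}
    (h : IsUnit T.adjoint) : IsUnit T := by
  rw [← ContinuousLinearMap.star_eq_adjoint] at h
  exact isUnit_star.1 h

lemma ContinuousLinearMap.inner_smul_apply (c : ℂ) (T : H →L[ℂ] H)
    (φ ψ : H) : inner ℂ ψ ((c • T) φ) = c * inner ℂ ψ (T φ) := by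
  rw [_root_.smul_apply, inner_smul_right]

/-- **Fredholm alternative** for a compact perturbation of an invertible operator. -/
lemma exists_ne_zero_of_not_isUnit_add [CompleteSpace H] {S K : H →L[ℂ] H} (hS : IsUnit S)
    (hK : IsCompactOperator K) (h : ¬ IsUnit (S + K)) : ∃ ψ : H, ψ ≠ 0 ∧ (S + K) ψ = 0 := by
  obtain ⟨u, rfl⟩ := hS
  -- With `S = u`, factor `S + K = S (1 + S⁻¹ K)`. Either `1` is an eigenvalue of the compact
  -- operator `-S⁻¹ K`, which gives a kernel vector, or `1` lies in its resolvent set and `S + K` is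
  -- invertible.
  have hc : IsCompactOperator (-((↑u⁻¹ : H →L[ℂ] H) * K) : H →L[ℂ] H) :=
    (hK.clm_comp (↑u⁻¹ : H →L[ℂ] H)).neg
  have hu : ∀ x, (u : H →L[ℂ] H) ((↑u⁻¹ : H →L[ℂ] H) x) = x := fun x => by
    rw [← mul_apply_eq_comp, Units.mul_inv, one_apply_eq_self]
  rcases hc.hasEigenvalue_or_mem_resolventSet one_ne_zero with he | hr
  · obtain ⟨ψ, hψ⟩ := he.exists_hasEigenvector
    refine ⟨ψ, hψ.2, ?_⟩
    have h1 : -((↑u⁻¹ : H →L[ℂ] H) (K ψ)) = ψ := by simpa using hψ.apply_eq_smul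
    have h2 := congrArg (u : H →L[ℂ] H) h1
    rw [map_neg, hu] at h2
    rw [_root_.add_apply, ← h2, neg_add_cancel]
  · refine absurd ?_ h
    rw [spectrum.mem_resolventSet_iff, map_one, sub_neg_eq_add] at hr
    have : (u : H →L[ℂ] H) + K = u * (1 + (↑u⁻¹ : H →L[ℂ] H) * K) := by
      rw [mul_add, mul_one, ← mul_assoc, Units.mul_inv, one_mul]
    rw [this]
    exact u.isUnit.mul hr

/-- The projection factors through `V`, which is locally compact. -/
lemma isCompactOperator_starProjection (V : Submodule ℂ L) [FiniteDimensional ℂ V] :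
    IsCompactOperator V.starProjection := by
  have : LocallyCompactSpace V := .of_finiteDimensional_of_complete ℂ V
  exact (isCompactOperator_of_locallyCompactSpace_rng V.subtypeL).comp_clm
    V.orthogonalProjectionOnto

/-- Parseval's identity. -/
lemma HilbertBasis.hasSum_sq_norm_inner (b : HilbertBasis ι ℂ L) (x : L) :
    HasSum (fun i => ‖inner ℂ (b i) x‖ ^ 2) (‖x‖ ^ 2) := by
  have h := RCLike.hasSum_re ℂ (b.hasSum_inner_mul_inner x x)
  rw [inner_self_eq_norm_sq] at h
  refine h.congr_fun fun i => ?_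
  rw [← inner_conj_symm x, RCLike.conj_mul]
  norm_cast

/-- An operator whose coefficients in a Hilbert basis are dominated, with a factor tending to zero,
by those of two bounded operators is a norm limit of finite rank operators. -/
lemma exists_norm_sub_starProjection_comp_le (b : HilbertBasis ι ℂ L) (J D₁ D₂ : H →L[ℂ] L)
    (h : ∀ ε > 0, ∃ s : Finset ι, ∀ n ∉ s, ∀ x, ‖inner ℂ (b n) (J x)‖ ^ 2 ≤
      ε * (‖inner ℂ (b n) (D₁ x)‖ ^ 2 + ‖inner ℂ (b n) (D₂ x)‖ ^ 2)) {ε : ℝ} (hε : 0 < ε) :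
    ∃ (V : Submodule ℂ L) (_ : FiniteDimensional ℂ V), ‖J - V.starProjection ∘L J‖ ≤ ε := by
  -- Scaled so that the summed bound becomes `(ε ‖x‖) ^ 2`; the `+ 1` keeps the denominator positive
  -- when `D₁ = D₂ = 0`.
  obtain ⟨s, hs⟩ := h (ε ^ 2 / (‖D₁‖ ^ 2 + ‖D₂‖ ^ 2 + 1)) (by positivity)
  let V : Submodule ℂ L := Submodule.span ℂ (b '' s)
  have hV : FiniteDimensional ℂ V := FiniteDimensional.span_of_finite ℂ (s.finite_toSet.image b)
  refine ⟨V, hV, ContinuousLinearMap.opNorm_le_bound _ hε.le fun x => ?_⟩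
  have hmem : ∀ n ∈ s, b n ∈ V := fun n hn => Submodule.subset_span ⟨n, hn, rfl⟩
  have hort : ∀ n ∉ s, b n ∈ Vᗮ := fun n hn => by
    refine (Submodule.mem_orthogonal _ _).2 fun v hv => ?_
    induction hv using Submodule.span_induction with
    | mem v hv =>
      obtain ⟨m, hm, rfl⟩ := hv
      exact b.orthonormal.2 fun e => hn (e ▸ hm)
    | zero => simp
    | add v w _ _ hv hw => rw [inner_add_left, hv, hw, add_zero]
    | smul c v _ hv => rw [inner_smul_left, hv, mul_zero]
  set y := (J - V.starProjection ∘L J) x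
  have hy' : y = J x - V.starProjection (J x) := rfl
  -- The residual `y` has no coefficients in `s`, and outside `s` it has those of `J x`.
  have hle : ∀ n, ‖inner ℂ (b n) y‖ ^ 2 ≤ ε ^ 2 / (‖D₁‖ ^ 2 + ‖D₂‖ ^ 2 + 1) *
      (‖inner ℂ (b n) (D₁ x)‖ ^ 2 + ‖inner ℂ (b n) (D₂ x)‖ ^ 2) := fun n => by
    by_cases hn : n ∈ s
    · have : inner ℂ (b n) y = 0 :=
        (Submodule.mem_orthogonal _ _).1 (V.sub_starProjection_mem_orthogonal (J x)) _ (hmem n hn)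
      rw [this, norm_zero, zero_pow two_ne_zero]
      positivity
    · have : inner ℂ (b n) (V.starProjection (J x)) = 0 :=
        (Submodule.mem_orthogonal' _ _).1 (hort n hn) _ (V.starProjection_apply_mem _)
      rw [hy', inner_sub_right, this, sub_zero]
      exact hs n hn x
  have hsum := hasSum_le hle (b.hasSum_sq_norm_inner y)
    (((b.hasSum_sq_norm_inner (D₁ x)).add (b.hasSum_sq_norm_inner (D₂ x))).mul_left _)
  refine le_of_sq_le_sq ?_ (by positivity)
  have h1 : ‖D₁ x‖ ^ 2 ≤ ‖D₁‖ ^ 2 * ‖x‖ ^ 2 := by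
    rw [← mul_pow]; gcongr; exact D₁.le_opNorm x
  have h2 : ‖D₂ x‖ ^ 2 ≤ ‖D₂‖ ^ 2 * ‖x‖ ^ 2 := by
    rw [← mul_pow]; gcongr; exact D₂.le_opNorm x
  calc ‖y‖ ^ 2 ≤ _ := hsum
    _ ≤ ε ^ 2 / (‖D₁‖ ^ 2 + ‖D₂‖ ^ 2 + 1) * ((‖D₁‖ ^ 2 + ‖D₂‖ ^ 2 + 1) * ‖x‖ ^ 2) := by
      gcongr
      nlinarith [sq_nonneg ‖x‖]
    _ = (ε * ‖x‖) ^ 2 := by field_simp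

lemma isCompactOperator_of_norm_sub_le {F G : Type*} [NormedAddCommGroup F] [NormedSpace ℂ F]
    [NormedAddCommGroup G] [NormedSpace ℂ G] [CompleteSpace G] {J : F →L[ℂ] G}
    (h : ∀ ε > 0, ∃ K : F →L[ℂ] G, IsCompactOperator K ∧ ‖J - K‖ ≤ ε) : IsCompactOperator J := by
  refine isClosed_setOfPred_isCompactOperator.closure_subset
    (Metric.mem_closure_iff.2 fun ε hε => ?_)
  obtain ⟨K, hK, hle⟩ := h (ε / 2) (half_pos hε)
  exact ⟨K, hK, by rw [dist_eq_norm]; linarith⟩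

/-- The adjoint needs no separate compactness theorem: taking adjoints is isometric and turns the
approximants `P J` into `J* P`, which are again compact. -/
lemma isCompactOperator_and_adjoint_of_coeff_le [CompleteSpace H] [CompleteSpace L]
    (b : HilbertBasis ι ℂ L) (J D₁ D₂ : H →L[ℂ] L)
    (h : ∀ ε > 0, ∃ s : Finset ι, ∀ n ∉ s, ∀ x, ‖inner ℂ (b n) (J x)‖ ^ 2 ≤
      ε * (‖inner ℂ (b n) (D₁ x)‖ ^ 2 + ‖inner ℂ (b n) (D₂ x)‖ ^ 2)) :
    IsCompactOperator J ∧ IsCompactOperator J.adjoint := by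
  constructor <;> refine isCompactOperator_of_norm_sub_le fun ε hε => ?_ <;>
    obtain ⟨V, hV, hle⟩ := exists_norm_sub_starProjection_comp_le b J D₁ D₂ h hε
  · exact ⟨_, (isCompactOperator_starProjection V).comp_clm J, hle⟩
  · refine ⟨J.adjoint ∘L V.starProjection, (isCompactOperator_starProjection V).clm_comp J.adjoint, ?_⟩
    have hV' : V.starProjection.adjoint = V.starProjection := (isSelfAdjoint_starProjection V)
    rw [← hV', ← ContinuousLinearMap.adjoint_comp, ← map_sub, LinearIsometryEquiv.norm_map]
    exact hle

end Compact

/-! ### Fourier series on the unit cell -/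

/-- The representative in `(0, L]` of a point of the unit circle rescaled to length `L`. -/
def circleLift (L : ℝ) (x : AddCircle (1 : ℝ)) : ℝ := L * (AddCircle.equivIoc 1 0 x : ℝ)

lemma coe_circleLift_div {L : ℝ} (hL : 0 < L) (x : AddCircle (1 : ℝ)) :
    ((circleLift L x / L : ℝ) : AddCircle (1 : ℝ)) = x := by
  rw [circleLift, mul_div_cancel_left₀ _ hL.ne']
  exact (AddCircle.equivIoc 1 0).symm_apply_apply x

lemma measurePreserving_circleLift {L : ℝ} (hL : 0 < L) :
    MeasurePreserving (circleLift L) AddCircle.haarAddCircle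
      (ENNReal.ofReal L⁻¹ • volume.restrict (Ioo 0 L)) := by
  have h1 : MeasurePreserving (fun x : AddCircle (1 : ℝ) => (AddCircle.equivIoc 1 0 x : ℝ))
      AddCircle.haarAddCircle (volume.restrict (Ioc 0 1)) := by
    have h := (measurePreserving_subtype_coe (μa := (volume : Measure ℝ))
      (measurableSet_Ioc (a := (0 : ℝ)) (b := 0 + 1))).comp
      (AddCircle.measurePreserving_equivIoc 1 (a := 0))
    -- On the circle of length one, volume and the normalised Haar measure agree.
    rw [AddCircle.volume_eq_smul_haarAddCircle, ENNReal.ofReal_one, one_smul] at h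
    rw [show Ioc (0 : ℝ) 1 = Ioc 0 (0 + 1) by rw [zero_add]]
    exact h
  have h2 : MeasurePreserving (fun x : ℝ => L * x) (volume.restrict (Ioc 0 1))
      (ENNReal.ofReal L⁻¹ • volume.restrict (Ioo 0 L)) := by
    refine ⟨measurable_const_mul L, ?_⟩
    have hpre : Ioc (0 : ℝ) 1 = (fun x : ℝ => L * x) ⁻¹' Ioc 0 L := by
      ext x
      simp only [mem_Ioc, mem_preimage, mul_pos_iff_of_pos_left hL, mul_le_iff_le_one_right hL]
    rw [hpre, ← Measure.restrict_map (measurable_const_mul L) measurableSet_Ioc,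
      Real.map_volume_mul_left hL.ne', abs_of_pos (inv_pos.2 hL), Measure.restrict_smul,
      restrict_Ioo_eq_restrict_Ioc]
  exact h2.comp h1

namespace PeriodicMedium

/-- Lift of the unit torus to the closed unit cell. -/
def torusLift (M : PeriodicMedium) (x : UnitAddTorus (Fin 2)) : ℝ × ℝ :=
  (circleLift M.ℓ (x 0), circleLift M.d (x 1))

/-- The normalised Haar measure of the two-dimensional unit torus. -/
abbrev torusMeasure : Measure (UnitAddTorus (Fin 2)) :=
  Measure.pi fun _ => AddCircle.haarAddCircle

/-- The product of two circle lifts. Through it, integrals over `Y` become torus integrals, where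
orthonormality and completeness of the exponentials are known. -/
lemma measurePreserving_torusLift (M : PeriodicMedium) :
    MeasurePreserving M.torusLift torusMeasure
      (ENNReal.ofReal (M.ℓ * M.d)⁻¹ • volume.restrict M.Y) := by
  have h := ((measurePreserving_circleLift M.ℓ_pos).prod
    (measurePreserving_circleLift M.d_pos)).comp
    (measurePreserving_piFinTwo fun _ : Fin 2 => AddCircle.haarAddCircle (T := 1))
  rw [Measure.prod_smul_left, Measure.prod_smul_right, smul_smul, ← M.measure_Y,
    ← ENNReal.ofReal_mul (inv_pos.2 M.ℓ_pos).le, ← mul_inv] at h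
  exact h

/-- The periodic exponential `exp (2πi (n₀ ξ₁ / ℓ + n₁ ξ₂ / d))`. -/
def character (M : PeriodicMedium) (n : Fin 2 → ℤ) (ξ : ℝ × ℝ) : ℂ :=
  Complex.exp ((2 * Real.pi * n 0 / M.ℓ * Complex.I) * ξ.1 +
    (2 * Real.pi * n 1 / M.d * Complex.I) * ξ.2)

lemma contDiff_character (M : PeriodicMedium) (n : Fin 2 → ℤ) :
    ContDiff ℝ (⊤ : ℕ∞) (M.character n) := by
  have h1 : ContDiff ℝ (⊤ : ℕ∞) fun ξ : ℝ × ℝ => (ξ.1 : ℂ) :=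
    Complex.ofRealCLM.contDiff.comp contDiff_fst
  have h2 : ContDiff ℝ (⊤ : ℕ∞) fun ξ : ℝ × ℝ => (ξ.2 : ℂ) :=
    Complex.ofRealCLM.contDiff.comp contDiff_snd
  exact ((contDiff_const.mul h1).add (contDiff_const.mul h2)).cexp

lemma fderiv_character (M : PeriodicMedium) (n : Fin 2 → ℤ) (ξ e : ℝ × ℝ) :
    fderiv ℝ (M.character n) ξ e = ((2 * Real.pi * n 0 / M.ℓ * Complex.I) * e.1 +
      (2 * Real.pi * n 1 / M.d * Complex.I) * e.2) * M.character n ξ := by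
  have h1 : HasFDerivAt (fun ξ : ℝ × ℝ => (ξ.1 : ℂ))
      (Complex.ofRealCLM ∘L ContinuousLinearMap.fst ℝ ℝ ℝ) ξ :=
    (Complex.ofRealCLM ∘L ContinuousLinearMap.fst ℝ ℝ ℝ).hasFDerivAt
  have h2 : HasFDerivAt (fun ξ : ℝ × ℝ => (ξ.2 : ℂ))
      (Complex.ofRealCLM ∘L ContinuousLinearMap.snd ℝ ℝ ℝ) ξ :=
    (Complex.ofRealCLM ∘L ContinuousLinearMap.snd ℝ ℝ ℝ).hasFDerivAt
  have h : HasFDerivAt (M.character n) _ ξ :=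
    ((h1.const_mul (2 * Real.pi * n 0 / M.ℓ * Complex.I)).add
      (h2.const_mul (2 * Real.pi * n 1 / M.d * Complex.I))).cexp
  rw [h.fderiv]
  simp [character]
  ring

lemma conj_character (M : PeriodicMedium) (n : Fin 2 → ℤ) (ξ : ℝ × ℝ) :
    conj (M.character n ξ) = M.character (-n) ξ := by
  rw [character, character, ← Complex.exp_conj]
  congr 1
  simp [Complex.conj_ofNat]
  ring

lemma character_torusLift (M : PeriodicMedium) (n : Fin 2 → ℤ) (x : UnitAddTorus (Fin 2)) :
    M.character n (M.torusLift x) = UnitAddTorus.mFourier n x := by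
  simp only [UnitAddTorus.mFourier, ContinuousMap.coe_mk, Fin.prod_univ_two]
  -- Each circle coordinate is written as the class of a real number, so that `fourier` becomes an
  -- explicit exponential.
  conv_rhs => rw [← coe_circleLift_div M.ℓ_pos (x 0), ← coe_circleLift_div M.d_pos (x 1)]
  rw [fourier_coe_apply, fourier_coe_apply, ← Complex.exp_add, character, torusLift]
  congr 1
  push_cast
  ring

/-- The two exponents differ by `n 0` times `2πi`. -/
lemma character_fst_periodic (M : PeriodicMedium) (n : Fin 2 → ℤ) (y : ℝ) :
    M.character n (M.ℓ, y) = M.character n (0, y) := by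
  have hℓ : (M.ℓ : ℂ) ≠ 0 := by exact_mod_cast M.ℓ_pos.ne'
  rw [character, character, Complex.exp_eq_exp_iff_exists_int]
  refine ⟨n 0, ?_⟩
  push_cast
  field_simp
  ring

lemma character_snd_periodic (M : PeriodicMedium) (n : Fin 2 → ℤ) (x : ℝ) :
    M.character n (x, M.d) = M.character n (x, 0) := by
  have hd : (M.d : ℂ) ≠ 0 := by exact_mod_cast M.d_pos.ne'
  rw [character, character, Complex.exp_eq_exp_iff_exists_int]
  refine ⟨n 1, ?_⟩
  push_cast
  field_simp
  ring

lemma integral_torusLift (M : PeriodicMedium) {F : ℝ × ℝ → ℂ}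
    (hF : AEStronglyMeasurable F (volume.restrict M.Y)) :
    ∫ x, F (M.torusLift x) ∂torusMeasure = ((M.ℓ * M.d)⁻¹ : ℝ) * ∫ ξ in M.Y, F ξ := by
  have h := M.measurePreserving_torusLift
  rw [← integral_map h.measurable.aemeasurable (by
    rw [h.map_eq]; exact hF.mono_ac (Measure.smul_absolutelyContinuous)), h.map_eq,
    integral_smul_measure, ENNReal.toReal_ofReal (by have := M.ℓ_pos; have := M.d_pos; positivity),
    Complex.real_smul]

/-- The normalised exponential as an element of `L²(Y)`. -/
def fourierMode (M : PeriodicMedium) (n : Fin 2 → ℤ) : M.L2Y :=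
  (((Real.sqrt (M.ℓ * M.d))⁻¹ : ℝ) : ℂ) •
    (M.memLp_Y (M.contDiff_character n).continuous).toLp (M.character n)

/-- Absorbing the conjugation into the index `-n` gives the unconjugated integrals that occur in the
trace conditions. -/
lemma inner_fourierMode (M : PeriodicMedium) (n : Fin 2 → ℤ) (g : M.L2Y) :
    inner ℂ (M.fourierMode n) g = (((Real.sqrt (M.ℓ * M.d))⁻¹ : ℝ) : ℂ) *
      ∫ ξ in M.Y, g ξ * M.character (-n) ξ := by
  rw [fourierMode, inner_smul_left, Complex.conj_ofReal, L2.inner_def]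
  congr 1
  apply integral_congr_ae
  filter_upwards [(M.memLp_Y (M.contDiff_character n).continuous).coeFn_toLp] with ξ hξ
  rw [hξ, RCLike.inner_apply, conj_character]

lemma orthonormal_fourierMode (M : PeriodicMedium) : Orthonormal ℂ M.fourierMode := by
  have hpos : 0 < M.ℓ * M.d := mul_pos M.ℓ_pos M.d_pos
  have hT := orthonormal_iff_ite.1 (UnitAddTorus.orthonormal_mFourier (d := Fin 2))
  rw [orthonormal_iff_ite]
  intro m n
  rw [← hT m n, ContinuousMap.inner_toLp, inner_fourierMode]
  have hc := (M.contDiff_character n).continuous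
  have hint : ∫ ξ in M.Y, M.fourierMode n ξ * M.character (-m) ξ =
      ∫ ξ in M.Y, (((Real.sqrt (M.ℓ * M.d))⁻¹ : ℝ) : ℂ) *
        (M.character n ξ * M.character (-m) ξ) := by
    apply integral_congr_ae
    filter_upwards [Lp.coeFn_smul (((Real.sqrt (M.ℓ * M.d))⁻¹ : ℝ) : ℂ)
      ((M.memLp_Y hc).toLp (M.character n)), (M.memLp_Y hc).coeFn_toLp] with ξ h1 h2
    rw [fourierMode, h1, Pi.smul_apply, h2, smul_eq_mul, mul_assoc]
  -- The two normalisations combine to the inverse area, which is the factor in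
  -- `integral_torusLift`.
  have hsq : (((Real.sqrt (M.ℓ * M.d))⁻¹ : ℝ) : ℂ) * (((Real.sqrt (M.ℓ * M.d))⁻¹ : ℝ) : ℂ) =
      ((M.ℓ * M.d)⁻¹ : ℝ) := by
    rw [← Complex.ofReal_mul, ← mul_inv, Real.mul_self_sqrt hpos.le]
  rw [hint, integral_const_mul, ← mul_assoc, hsq, ← M.integral_torusLift
    (F := fun ξ => M.character n ξ * M.character (-m) ξ) (hc.mul (M.contDiff_character (-m)).continuous).aestronglyMeasurable]
  apply integral_congr_ae
  refine Filter.Eventually.of_forall fun x => ?_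
  simp only [character_torusLift, UnitAddTorus.mFourier_neg]

/-- If `g` is orthogonal to all modes, its pullback to the torus has zero Fourier coefficients and
so vanishes almost everywhere. This passes back to `Y` because the lift carries Haar measure to a
positive multiple of Lebesgue measure. -/
lemma span_fourierMode_orthogonal (M : PeriodicMedium) :
    (Submodule.span ℂ (range M.fourierMode))ᗮ = ⊥ := by
  have hpos : 0 < M.ℓ * M.d := mul_pos M.ℓ_pos M.d_pos
  have hr := M.measurePreserving_torusLift
  rw [Submodule.eq_bot_iff]
  intro g hg
  have h0 : ∀ n, ∫ ξ in M.Y, g ξ * M.character (-n) ξ = 0 := fun n => by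
    have := (Submodule.mem_orthogonal _ _).1 hg _ (Submodule.subset_span ⟨n, rfl⟩)
    rw [inner_fourierMode, mul_eq_zero] at this
    refine this.resolve_left ?_
    exact_mod_cast (inv_pos.2 (Real.sqrt_pos.2 hpos)).ne'
  have hgT : MemLp (fun x => g (M.torusLift x)) 2 torusMeasure :=
    ((Lp.memLp g).smul_measure ENNReal.ofReal_ne_top).comp_measurePreserving hr
  let f : Lp ℂ 2 torusMeasure := hgT.toLp _
  have hf0 : f = 0 := by
    apply (UnitAddTorus.mFourierBasis (d := Fin 2)).repr.injective
    rw [map_zero]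
    ext n
    rw [UnitAddTorus.mFourierBasis_repr]
    have : ∫ x, g (M.torusLift x) * M.character (-n) (M.torusLift x) ∂torusMeasure = 0 := by
      rw [M.integral_torusLift (F := fun ξ => g ξ * M.character (-n) ξ)
        ((Lp.aestronglyMeasurable g).mul
        (M.contDiff_character (-n)).continuous.aestronglyMeasurable), h0, mul_zero]
    refine Eq.trans ?_ this
    apply integral_congr_ae
    filter_upwards [hgT.coeFn_toLp] with x hx
    rw [character_torusLift, smul_eq_mul, mul_comm]
    exact congrArg (· * _) hx
  have h1 : ∀ᵐ x ∂torusMeasure, g (M.torusLift x) = 0 := by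
    have := (Lp.eq_zero_iff_ae_eq_zero).1 hf0
    filter_upwards [this, hgT.coeFn_toLp] with x hx hx'
    rw [← hx']; exact hx
  rw [Lp.eq_zero_iff_ae_eq_zero]
  have h2 : ∀ᵐ ξ ∂(ENNReal.ofReal (M.ℓ * M.d)⁻¹ • volume.restrict M.Y), g ξ = 0 := by
    rw [← hr.map_eq]
    refine (ae_map_iff hr.measurable.aemeasurable ?_).2 h1
    exact (Lp.stronglyMeasurable g).measurable (measurableSet_singleton 0)
  rwa [Measure.ae_ennreal_smul_measure_eq (by rw [Ne, ENNReal.ofReal_eq_zero, not_le]; positivity)] at h2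

/-- The exponentials form a Hilbert basis of `L²(Y)`. -/
def fourierBasisY (M : PeriodicMedium) : HilbertBasis (Fin 2 → ℤ) ℂ M.L2Y :=
  HilbertBasis.mkOfOrthogonalEqBot M.orthonormal_fourierMode M.span_fourierMode_orthogonal

lemma coe_fourierBasisY (M : PeriodicMedium) : ⇑M.fourierBasisY = M.fourierMode :=
  HilbertBasis.coe_mkOfOrthogonalEqBot _ _

/-! ### The Rellich theorem for periodic functions -/

/-- Green's formula tested with the exponential of index `-n`: both sides carry the same trace `t`
and the exponential is periodic, so the boundary integral is zero. The sign from integrating by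
parts cancels the one from `-n`. -/
lemma inner_fourierBasisY_fst (M : PeriodicMedium) (φ : M.H1p) (n : Fin 2 → ℤ) :
    inner ℂ (M.fourierBasisY n) (φ.1 1) =
      (2 * Real.pi * n 0 / M.ℓ * Complex.I) * inner ℂ (M.fourierBasisY n) (φ.1 0) := by
  obtain ⟨-, -, ⟨t, ht⟩, -⟩ := φ.2
  have h := ht _ (M.contDiff_character (-n))
  have hc := M.memLp_Y (M.contDiff_character (-n)).continuous
  simp only [character_fst_periodic, sub_self, integral_zero] at h
  rw [integral_add (integrable_mul (Lp.memLp _) (M.memLp_Y (cont_fderiv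
    (M.contDiff_character (-n)) _))) (integrable_mul (Lp.memLp _) hc)] at h
  simp only [fderiv_character, mul_left_comm _ (_ + _), integral_const_mul] at h
  rw [coe_fourierBasisY, inner_fourierMode, inner_fourierMode]
  simp only [Pi.neg_apply, Int.cast_neg, Complex.ofReal_one, Complex.ofReal_zero] at h
  linear_combination (((Real.sqrt (M.ℓ * M.d))⁻¹ : ℝ) : ℂ) * h

lemma inner_fourierBasisY_snd (M : PeriodicMedium) (φ : M.H1p) (n : Fin 2 → ℤ) :
    inner ℂ (M.fourierBasisY n) (φ.1 2) =
      (2 * Real.pi * n 1 / M.d * Complex.I) * inner ℂ (M.fourierBasisY n) (φ.1 0) := by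
  obtain ⟨-, -, -, ⟨t, ht⟩⟩ := φ.2
  have h := ht _ (M.contDiff_character (-n))
  have hc := M.memLp_Y (M.contDiff_character (-n)).continuous
  simp only [character_snd_periodic, sub_self, integral_zero] at h
  rw [integral_add (integrable_mul (Lp.memLp _) (M.memLp_Y (cont_fderiv
    (M.contDiff_character (-n)) _))) (integrable_mul (Lp.memLp _) hc)] at h
  simp only [fderiv_character, mul_left_comm _ (_ + _), integral_const_mul] at h
  rw [coe_fourierBasisY, inner_fourierMode, inner_fourierMode]
  simp only [Pi.neg_apply, Int.cast_neg, Complex.ofReal_one, Complex.ofReal_zero] at h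
  linear_combination (((Real.sqrt (M.ℓ * M.d))⁻¹ : ℝ) : ℂ) * h

/-- A nonzero integer satisfies `k ^ 2 ≥ |k|`, so `k ^ 2 ≥ N ≥ L ^ 2 / ε`; the factor `(2π) ^ 2 ≥ 1`
is simply discarded. -/
lemma one_le_mul_sq_freq {L ε : ℝ} {N : ℕ} {k : ℤ} (hL : 0 < L) (hε : 0 < ε)
    (hN : L ^ 2 / ε ≤ N) (hk : (N : ℤ) < |k|) : 1 ≤ ε * (2 * Real.pi * k / L) ^ 2 := by
  have h1 : (N : ℝ) ≤ |(k : ℝ)| := by exact_mod_cast hk.le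
  have h2 : (1 : ℝ) ≤ |(k : ℝ)| := by
    have : (1 : ℤ) ≤ |k| := by omega
    exact_mod_cast this
  have h3 : L ^ 2 / ε ≤ (k : ℝ) ^ 2 := by nlinarith [sq_abs (k : ℝ)]
  have hπ : 1 ≤ (2 * Real.pi) ^ 2 := by nlinarith [Real.pi_gt_three]
  rw [div_le_iff₀ hε] at h3
  rw [div_pow, mul_pow, ← mul_div_assoc, le_div_iff₀ (by positivity), one_mul]
  have : 0 ≤ (k : ℝ) ^ 2 * ε := by positivity
  nlinarith

/-- The components `φ ↦ φ, ∂φ/∂ξ₁, ∂φ/∂ξ₂` as bounded operators. -/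
def component (M : PeriodicMedium) (i : Fin 3) : M.H1p →L[ℂ] M.L2Y :=
  (PiLp.proj 2 (fun _ : Fin 3 => M.L2Y) i : _ →L[ℂ] M.L2Y) ∘L M.H1p.subtypeL

lemma component_apply (M : PeriodicMedium) (i : Fin 3) (φ : M.H1p) : M.component i φ = φ.1 i := rfl

/-- The embedding of `H¹_p(Y)` into `L²(Y)` and its adjoint are compact. -/
theorem isCompactOperator_embedding (M : PeriodicMedium) :
    IsCompactOperator (M.component 0) ∧ IsCompactOperator (M.component 0).adjoint := by
  refine isCompactOperator_and_adjoint_of_coeff_le M.fourierBasisY _ (M.component 1)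
    (M.component 2) fun ε hε => ?_
  -- Outside the box `|n 0|, |n 1| ≤ N` at least one index exceeds `N`, and the corresponding
  -- derivative alone dominates.
  obtain ⟨N, hN⟩ := exists_nat_ge (max (M.ℓ ^ 2 / ε) (M.d ^ 2 / ε))
  refine ⟨Fintype.piFinset fun _ => Finset.Icc (-N : ℤ) N, fun n hn φ => ?_⟩
  have hfreq : 1 ≤ ε * ((2 * Real.pi * n 0 / M.ℓ) ^ 2 + (2 * Real.pi * n 1 / M.d) ^ 2) := by
    simp only [Fintype.mem_piFinset, Finset.mem_Icc, ← abs_le, Fin.forall_fin_two, not_and_or,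
      not_le] at hn
    rw [mul_add]
    rcases hn with hn | hn
    · have := one_le_mul_sq_freq M.ℓ_pos hε ((le_max_left _ _).trans hN) hn
      have h0 : 0 ≤ ε * (2 * Real.pi * n 1 / M.d) ^ 2 := by positivity
      linarith
    · have := one_le_mul_sq_freq M.d_pos hε ((le_max_right _ _).trans hN) hn
      have h0 : 0 ≤ ε * (2 * Real.pi * n 0 / M.ℓ) ^ 2 := by positivity
      linarith
  have hnorm : ∀ (L : ℝ) (k : ℤ),
      ‖(2 * Real.pi * k / L * Complex.I : ℂ)‖ ^ 2 = (2 * Real.pi * k / L) ^ 2 := fun L k => by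
    have : (2 * Real.pi * k / L * Complex.I : ℂ) = ((2 * Real.pi * k / L : ℝ) : ℂ) * Complex.I := by
      push_cast; ring
    rw [this, norm_mul, Complex.norm_I, mul_one, Complex.norm_real, Real.norm_eq_abs, sq_abs]
  simp only [component_apply]
  rw [inner_fourierBasisY_fst, inner_fourierBasisY_snd, norm_mul (_ * Complex.I),
    norm_mul (_ * Complex.I), mul_pow, mul_pow, hnorm, hnorm, ← add_mul, ← mul_assoc]
  exact le_mul_of_one_le_left (by positivity) hfreq

/-! ### The operator pencil -/

/-- The forms `∫ a ∂ᵢφ ∂ⱼψ̄`, where `∂₀` is the identity, are represented by bounded operators,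
which are compact when they involve `φ` or `ψ` without derivative. -/
lemma exists_op_isCompactOperator (M : PeriodicMedium) {a : ℝ × ℝ → ℂ}
    (ha : MemLp a ⊤ (volume.restrict M.Y)) (i j : Fin 3) :
    ∃ T : M.H1p →L[ℂ] M.H1p,
      (∀ φ ψ : M.H1p, inner ℂ ψ (T φ) = ∫ ξ in M.Y, a ξ * (φ.1 i ξ * conj (ψ.1 j ξ))) ∧
      (i = 0 ∨ j = 0 → IsCompactOperator T) := by
  let m : M.L2Y →L[ℂ] M.L2Y :=
    (ContinuousLinearMap.mul ℂ ℂ).holderL (volume.restrict M.Y) ⊤ 2 2 (ha.toLp a)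
  refine ⟨(M.component j).adjoint ∘L m ∘L (M.component i), fun φ ψ => ?_, ?_⟩
  · simp only [ContinuousLinearMap.comp_apply]
    rw [ContinuousLinearMap.adjoint_inner_right, L2.inner_def]
    apply integral_congr_ae
    have h1 : m (M.component i φ) =ᵐ[volume.restrict M.Y] _ :=
      (ContinuousLinearMap.mul ℂ ℂ).coeFn_holder (ha.toLp a) (M.component i φ)
    filter_upwards [h1, ha.coeFn_toLp] with ξ h2 h3
    rw [h2, h3]
    simp [component_apply, mul_assoc]
  -- The compact factor is the embedding on the right if `i = 0`, and its adjoint on the left if `j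
  -- = 0`.
  · rintro (rfl | rfl)
    · exact M.isCompactOperator_embedding.1.clm_comp ((M.component j).adjoint ∘L m)
    · exact M.isCompactOperator_embedding.2.comp_clm (m ∘L M.component i)

lemma inner_pencil (M : PeriodicMedium) (ω k₂ : ℝ) (z : ℂ) (φ ψ : M.H1p) :
    inner ℂ ψ (M.pencil ω k₂ z φ) = M.formA ω k₂ φ ψ + z * M.formB φ ψ + z ^ 2 * M.formC φ ψ := by
  simp only [pencil, _root_.add_apply, inner_add_right, ContinuousLinearMap.inner_smul_apply, inner_opA, inner_opB,
    inner_opC]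

/-- The pencil is the sum of an invertible and a compact operator. -/
lemma exists_pencil_eq_add (M : PeriodicMedium) (ω k₂ : ℝ) (z : ℂ) :
    ∃ S K : M.H1p →L[ℂ] M.H1p, IsUnit S ∧ IsCompactOperator K ∧ M.pencil ω k₂ z = S + K := by
  obtain ⟨T₀₀, h₀₀, c₀₀⟩ := M.exists_op_isCompactOperator M.memLp_G 0 0
  obtain ⟨T₁₀, h₁₀, c₁₀⟩ := M.exists_op_isCompactOperator M.memLp_G 1 0
  obtain ⟨T₀₁, h₀₁, c₀₁⟩ := M.exists_op_isCompactOperator M.memLp_G 0 1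
  obtain ⟨T₂₀, h₂₀, c₂₀⟩ := M.exists_op_isCompactOperator M.memLp_G 2 0
  obtain ⟨T₀₂, h₀₂, c₀₂⟩ := M.exists_op_isCompactOperator M.memLp_G 0 2
  obtain ⟨R, hR, cR⟩ := M.exists_op_isCompactOperator M.memLp_ρ 0 0
  obtain ⟨T₁₁, h₁₁, -⟩ := M.exists_op_isCompactOperator M.memLp_G 1 1
  obtain ⟨T₂₂, h₂₂, -⟩ := M.exists_op_isCompactOperator M.memLp_G 2 2
  -- The mass term `T₀₀` is added to the gradient terms to obtain coercivity in the full `H¹` norm;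
  -- the `- 1` in the compact part removes it again.
  refine ⟨T₀₀ + T₁₁ + T₂₂, (((k₂ : ℂ) ^ 2 + z ^ 2 - 1) • T₀₀
    - ((k₂ : ℂ) * Complex.I) • (T₂₀ - T₀₂)) - ((ω : ℂ) ^ 2 • R
    + (z * Complex.I) • (T₁₀ - T₀₁)), ?_, ?_, ?_⟩
  -- Lax–Milgram with coercivity constant `M.Ginf`, obtained by applying `G ≥ Ginf` to each of the
  -- three components.
  · refine ContinuousLinearMap.isUnit_of_forall_le_norm_inner_map _
      (c := ⟨M.Ginf, M.Ginf_pos.le⟩) M.Ginf_pos fun φ => ?_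
    rw [← norm_inner_symm]
    have hle : ∀ i : Fin 3, M.Ginf * ‖φ.1 i‖ ^ 2 ≤
        RCLike.re (∫ ξ in M.Y, (M.G ξ : ℂ) * (φ.1 i ξ * conj (φ.1 i ξ))) := fun i => by
      have hn : ‖φ.1 i‖ ^ 2 = ∫ ξ in M.Y, ‖φ.1 i ξ‖ ^ 2 := by
        rw [← inner_self_eq_norm_sq (𝕜 := ℂ), L2.inner_def,
          ← integral_re (L2.integrable_inner (𝕜 := ℂ) _ _)]
        simp only [inner_self_eq_norm_sq]
      rw [hn, ← integral_re (M.integrable_form M.memLp_G _ _), ← integral_const_mul]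
      refine integral_mono_ae ((Lp.memLp (φ.1 i)).integrable_norm_pow two_ne_zero |>.const_mul _)
        (M.integrable_form M.memLp_G _ _).re ?_
      filter_upwards [M.G_bound] with ξ hξ
      have : (M.G ξ : ℂ) * (φ.1 i ξ * conj (φ.1 i ξ)) = ((M.G ξ * ‖φ.1 i ξ‖ ^ 2 : ℝ) : ℂ) := by
        rw [Complex.mul_conj']; push_cast; rfl
      rw [this]
      exact mul_le_mul_of_nonneg_right hξ.1 (by positivity)
    have hnorm : ‖φ‖ ^ 2 = ‖φ.1 0‖ ^ 2 + ‖φ.1 1‖ ^ 2 + ‖φ.1 2‖ ^ 2 := by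
      rw [← Fin.sum_univ_three (fun i => ‖φ.1 i‖ ^ 2), ← PiLp.norm_sq_eq_of_L2]
      rfl
    refine le_trans ?_ (RCLike.re_le_norm _)
    rw [_root_.add_apply, _root_.add_apply, inner_add_right, inner_add_right, h₀₀, h₁₁, h₂₂,
      map_add, map_add, hnorm]
    have := hle 0
    have := hle 1
    have := hle 2
    change _ * M.Ginf ≤ _
    linarith
  · let 𝒦 := compactOperator (RingHom.id ℂ) M.H1p M.H1p
    have m₀₀ : T₀₀ ∈ 𝒦 := c₀₀ (Or.inl rfl)
    have m₁₀ : T₁₀ ∈ 𝒦 := c₁₀ (Or.inr rfl)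
    have m₀₁ : T₀₁ ∈ 𝒦 := c₀₁ (Or.inl rfl)
    have m₂₀ : T₂₀ ∈ 𝒦 := c₂₀ (Or.inr rfl)
    have m₀₂ : T₀₂ ∈ 𝒦 := c₀₂ (Or.inl rfl)
    have mR : R ∈ 𝒦 := cR (Or.inl rfl)
    exact 𝒦.sub_mem (𝒦.sub_mem (𝒦.smul_mem _ m₀₀) (𝒦.smul_mem _ (𝒦.sub_mem m₂₀ m₀₂)))
      (𝒦.add_mem (𝒦.smul_mem _ mR) (𝒦.smul_mem _ (𝒦.sub_mem m₁₀ m₀₁)))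
  · ext1 φ
    refine ext_inner_left ℂ fun ψ => ?_
    have hi := M.integrable_form M.memLp_G
    simp only [inner_pencil, ContinuousLinearMap.inner_smul_apply, _root_.add_apply, _root_.sub_apply,
      inner_add_right, inner_sub_right, h₀₀, h₁₀, h₀₁, h₂₀, h₀₂, h₁₁, h₂₂, hR, formA, formB, formC, fn, d1, d2, mul_sub, mul_add, mul_assoc]
    rw [integral_sub (hi _ _) (hi _ _), integral_sub (hi _ _) (hi _ _),
      integral_add (hi _ _) (hi _ _)]
    ring

/-! ### Hermitian symmetry of the forms and the conjugate eigenvalue -/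

lemma conj_formC (M : PeriodicMedium) (φ ψ : M.H1p) : conj (M.formC φ ψ) = M.formC ψ φ := by
  simp only [formC, ← integral_conj]
  congr 1 with ξ
  simp
  ring

/-- Conjugation sends the integral to minus the one with `φ` and `ψ` exchanged, and this sign is
cancelled by that of the conjugated prefactor `-i`. -/
lemma conj_formB (M : PeriodicMedium) (φ ψ : M.H1p) : conj (M.formB φ ψ) = M.formB ψ φ := by
  simp only [formB, map_mul, ← integral_conj]
  rw [← neg_neg (conj (-Complex.I)), neg_mul, ← mul_neg, ← integral_neg]
  congr 1
  · simp
  · congr 1 with ξ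
    simp
    ring

lemma conj_formA (M : PeriodicMedium) (ω k₂ : ℝ) (φ ψ : M.H1p) :
    conj (M.formA ω k₂ φ ψ) = M.formA ω k₂ ψ φ := by
  have h1 : conj (∫ ξ in M.Y, (M.ρ ξ : ℂ) * fn φ ξ * conj (fn ψ ξ)) =
      ∫ ξ in M.Y, (M.ρ ξ : ℂ) * fn ψ ξ * conj (fn φ ξ) := by
    rw [← integral_conj]
    congr 1 with ξ
    simp
    ring
  have h2 : conj (∫ ξ in M.Y, (M.G ξ : ℂ) * (d2 φ ξ * conj (fn ψ ξ) - fn φ ξ * conj (d2 ψ ξ))) =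
      - ∫ ξ in M.Y, (M.G ξ : ℂ) * (d2 ψ ξ * conj (fn φ ξ) - fn ψ ξ * conj (d2 φ ξ)) := by
    rw [← integral_conj, ← integral_neg]
    congr 1 with ξ
    simp
    ring
  have h3 : conj (∫ ξ in M.Y, (M.G ξ : ℂ) * (d1 φ ξ * conj (d1 ψ ξ) + d2 φ ξ * conj (d2 ψ ξ))) =
      ∫ ξ in M.Y, (M.G ξ : ℂ) * (d1 ψ ξ * conj (d1 φ ξ) + d2 ψ ξ * conj (d2 φ ξ)) := by
    rw [← integral_conj]
    congr 1 with ξ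
    simp only [map_mul, map_add, Complex.conj_ofReal, Complex.conj_conj]
    ring
  have h4 := M.conj_formC φ ψ
  simp only [formC] at h4
  simp only [formA, map_add, map_sub, map_mul, map_pow, Complex.conj_ofReal, Complex.conj_I, h1,
    h2, h3, h4]
  ring

lemma adjoint_pencil (M : PeriodicMedium) (ω k₂ : ℝ) (z : ℂ) :
    (M.pencil ω k₂ z).adjoint = M.pencil ω k₂ (conj z) := by
  ext1 φ
  refine ext_inner_left ℂ fun ψ => ?_
  rw [ContinuousLinearMap.adjoint_inner_right, ← inner_conj_symm, inner_pencil, inner_pencil]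
  simp only [map_add, map_mul, map_pow, conj_formA, conj_formB, conj_formC]

/-- Non-invertibility passes to the adjoint, which is the pencil at `conj z`, and there the Fredholm
alternative turns it into a kernel vector. -/
lemma exists_pencil_conj_eq_zero (M : PeriodicMedium) (ω k₂ : ℝ) (z : ℂ)
    (h : ∃ φ : M.H1p, φ ≠ 0 ∧ M.pencil ω k₂ z φ = 0) :
    ∃ ψ : M.H1p, ψ ≠ 0 ∧ M.pencil ω k₂ (conj z) ψ = 0 := by
  obtain ⟨φ, hφ, h0⟩ := h
  have hz : ¬ IsUnit (M.pencil ω k₂ z) := fun hu =>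
    hφ ((ContinuousLinearMap.isUnit_iff_bijective.1 hu).1 (h0.trans (map_zero _).symm))
  have hz' : ¬ IsUnit (M.pencil ω k₂ (conj z)) := by
    rw [← adjoint_pencil]
    exact fun hu => hz (ContinuousLinearMap.isUnit_of_isUnit_adjoint hu)
  obtain ⟨S, K, hS, hK, hSK⟩ := M.exists_pencil_eq_add ω k₂ (conj z)
  rw [hSK] at hz' ⊢
  exact exists_ne_zero_of_not_isUnit_add hS hK hz'

/-- The weak form of the eigenvalue problem and the pencil have the same eigenvalues. -/
lemma isEigenvalue_iff_exists_pencil_eq_zero (M : PeriodicMedium) (ω k₂ : ℝ) (κ : ℂ) :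
    M.IsEigenvalue ω k₂ κ ↔ ∃ φ : M.H1p, φ ≠ 0 ∧ M.pencil ω k₂ κ φ = 0 := by
  refine exists_congr fun φ => and_congr_right fun _ => ?_
  rw [ext_iff_inner_left ℂ]
  refine forall_congr' fun ψ => ?_
  rw [inner_zero_right, inner_pencil]
  refine Eq.congr ?_ rfl
  simp only [formA, formB, formC]
  ring

end PeriodicMedium

end

theorem proposition1 (M : PeriodicMedium) (ω k₂ : ℝ) (hω : 0 < ω) :
    (∀ z : ℂ, (∃ φ : M.H1p, φ ≠ 0 ∧ M.pencil ω k₂ z φ = 0) →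
      ∃ ψ : M.H1p, ψ ≠ 0 ∧ M.pencil ω k₂ (starRingEnd ℂ z) ψ = 0) ∧
    (∀ κ : ℂ, M.IsEigenvalue ω k₂ κ ↔ M.IsEigenvalue ω k₂ (starRingEnd ℂ κ)) := by
  refine ⟨M.exists_pencil_conj_eq_zero ω k₂, fun κ => ?_⟩
  simp only [PeriodicMedium.isEigenvalue_iff_exists_pencil_eq_zero]
  refine ⟨M.exists_pencil_conj_eq_zero ω k₂ κ, fun h => ?_⟩
  simpa using M.exists_pencil_conj_eq_zero ω k₂ _ h
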